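/- Rings are associative and not necessarily unital. In a ring with involution ($*$-ring), $x\ge 0$ ("$x$ is positive") means that $x$ is a finite sum of elements of the form $yy^*$, and $x>0$ means $x\ge 0$ and $x\ne 0$; the $*$-ring $R$ is positive definite if $\sum_{i=1}^n x_ix_i^*=0$ implies $x_1=\dots=x_n=0$. A map $t$ between $*$-rings is positive if $x\ge 0$ implies $t(x)\ge 0$, and faithful if $x>0$ implies $t(x)>0$. Let $K$ be a field with an involution, $E=(E^0,E^1,\mathbf s,\mathbf r)$ an arbitrary directed graph, and $S$ a set of regular vertices of $E$ (a vertex $v$ is regular if $\mathbf s^{-1}(v)$ is nonempty and finite). The Cohn–Leavitt algebra $CL_K(E,S)$ is the free $K$-algebra generated by $E^0\cup E^1\cup\{e^*\mid e\in E^1\}$ subject to the relations, for all vertices $v,w$ and edges $e,f$, (V) $vw=\delta_{v,w}v$; (E1) $\mathbf s(e)e=e\mathbf r(e)=e$; (E2) $\mathbf r(e)e^*=e^*\mathbf s(e)=e^*$; (CK1) $e^*f=\delta_{e,f}\mathbf r(e)$; (SCK2) $v=\sum_{e\in\mathbf s^{-1}(v)}ee^*$ for every $v\in S$. It carries the involution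 that extends the one of $K$ and satisfies $v^*=v$ and $(e)^*=e^*$ for all vertices $v$ and edges $e$, so that $(\sum a_ip_iq_i^*)^*=\sum a_i^*q_ip_i^*$ for $a_i\in K$ and paths $p_i,q_i$ (vertices are paths of length zero). Let $R$ be an involutive $K$-algebra (so $(ax)^*=a^*x^*$ for $a\in K$, $x\in R$) and let $t:CL_K(E,S)\to R$ be a $K$-linear trace, that is, a $K$-linear map with $t(xy)=t(yx)$ for all $x,y$, which is canonical: $t(pq^*)=\delta_{p,q}\,t(\mathbf r(p))$ for all paths $p$ and $q$. Consider the conditions (P) $t\bigl(v-\sum_{e\in I}\mathbf r(e)\bigr)\ge 0$ for all vertices $v$ and all finite subsets $I$ of $\mathbf s^{-1}(v)$; (F) $t(v)>0$ for all vertices $v$; (SF) $t\bigl(v-\sum_{e\in\mathbf s^{-1}(v)}\mathbf r(e)\bigr)>0$ for all regular vertices $v$ not in $S$. Then $t$ is positive if and only if (P) holds. If $R$ is positive definite, then $t$ is faithful if and only if (P), (F) and (SF) hold. -/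

import Mathlib

universe u v w

/-! ### Directed graphs and paths -/

/-- A directed graph with vertex set `V`, edge set `E`, source map `s` and range map `r`.
No finiteness or countability is assumed. -/
structure DirectedGraph (V : Type u) (E : Type v) where
  s : E → V
  r : E → V

namespace DirectedGraph

variable {V : Type u} {E : Type v}

/-- The set `s⁻¹(x)` of edges emitted by `x`. -/
def emitted (G : DirectedGraph V E) (x : V) : Set E := {e | G.s e = x}

/-- A vertex is regular if it emits at least one and only finitely many edges. -/
def IsRegular (G : DirectedGraph V E) (x : V) : Prop :=
  (G.emitted x).Nonempty ∧ (G.emitted x).Finite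

/-- The finite set `s⁻¹(x)` of a regular vertex `x`. -/
noncomputable def IsRegular.edges {G : DirectedGraph V E} {x : V} (h : G.IsRegular x) : Finset E :=
  h.2.toFinset

/-- `G.IsWalk x l y`: the edges in `l` can be traversed one after the other, starting in `x` and
ending in `y`. The empty list is a walk from each vertex to itself. -/
def IsWalk (G : DirectedGraph V E) : V → List E → V → Prop
  | x, [], y => x = y
  | x, e :: l, y => G.s e = x ∧ G.IsWalk (G.r e) l y

/-- A path: a finite sequence of composable edges; the paths of length zero are the vertices. -/
@[ext]
structure Path (G : DirectedGraph V E) where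
  source : V
  edges : List E
  range : V
  isWalk : G.IsWalk source edges range

end DirectedGraph

/-! ### Cohn-Leavitt algebras by generators and relations -/

/-- The generators `E⁰ ∪ E¹ ∪ {e* | e ∈ E¹}`. -/
inductive CLGen (V : Type u) (E : Type v)
  | vert : V → CLGen V E
  | edge : E → CLGen V E
  | ghost : E → CLGen V E

namespace CLGen

variable {V : Type u} {E : Type v}

/-- `v* = v`, `(e)* = e*`, `(e*)* = e`. -/
def inv : CLGen V E → CLGen V E
  | vert x => vert x
  | edge e => ghost e
  | ghost e => edge e

theorem inv_inv (g : CLGen V E) : g.inv.inv = g := by cases g <;> rfl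

/-- The anti-automorphism of the free semigroup extending `CLGen.inv`. -/
def wordInv : FreeSemigroup (CLGen V E) →ₙ* (FreeSemigroup (CLGen V E))ᵐᵒᵖ :=
  FreeSemigroup.lift fun g => MulOpposite.op (FreeSemigroup.of g.inv)

theorem wordInv_wordInv (x : FreeSemigroup (CLGen V E)) :
    (wordInv (wordInv x).unop).unop = x := by
  induction x with
  | ih1 g => simp [wordInv, inv_inv]
  | ih2 g y h1 h2 => simp only [map_mul, MulOpposite.unop_mul, h1, h2]

end CLGen

/-- The free associative (not necessarily unital) `K`-algebra on the generators. -/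
abbrev CLFree (K : Type w) [Field K] (V : Type u) (E : Type v) :=
  MonoidAlgebra K (FreeSemigroup (CLGen V E))

namespace CLFree

variable {K : Type w} [Field K] {V : Type u} {E : Type v}

/-- A generator as an element of the free algebra. -/
noncomputable def gen (g : CLGen V E) : CLFree K V E :=
  MonoidAlgebra.single (FreeSemigroup.of g) 1

variable [StarRing K]

/-- The conjugate-linear involution `∑ aᵢ wᵢ ↦ ∑ aᵢ* wᵢ*` of the free algebra. -/
noncomputable def inv : CLFree K V E →+ CLFree K V E :=
  (Finsupp.liftAddHom fun x : FreeSemigroup (CLGen V E) =>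
    (MonoidAlgebra.singleAddHom (R := K) (CLGen.wordInv x).unop).comp
      (starAddEquiv : K ≃+ K).toAddMonoidHom).comp
    (MonoidAlgebra.coeffAddEquiv : CLFree K V E ≃+ _).toAddMonoidHom

theorem inv_single (x : FreeSemigroup (CLGen V E)) (a : K) :
    inv (MonoidAlgebra.single x a : CLFree K V E)
      = MonoidAlgebra.single (CLGen.wordInv x).unop (star a) := by
  simp [inv]

theorem inv_gen (g : CLGen V E) : inv (gen g : CLFree K V E) = gen g.inv := by
  rw [gen, inv_single, star_one]; rfl

theorem inv_inv (x : CLFree K V E) : inv (inv x) = x := by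
  have h : (inv.comp inv : CLFree K V E →+ CLFree K V E) = AddMonoidHom.id _ := by
    apply MonoidAlgebra.addMonoidHom_ext
    intro m a
    simp [inv_single, CLGen.wordInv_wordInv]
  exact DFunLike.congr_fun h x

theorem inv_smul (a : K) (x : CLFree K V E) : inv (a • x) = star a • inv x := by
  induction x using MonoidAlgebra.induction_linear with
  | zero => simp
  | add f g hf hg => rw [smul_add, map_add, hf, hg, map_add, smul_add]
  | single m b => simp [inv_single]

theorem inv_mul (x y : CLFree K V E) : inv (x * y) = inv y * inv x := by
  induction x using MonoidAlgebra.induction_linear with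
  | zero => simp
  | add f g hf hg => rw [add_mul, map_add, hf, hg, map_add, mul_add]
  | single m b =>
    induction y using MonoidAlgebra.induction_linear with
    | zero => simp
    | add f g hf hg => rw [mul_add, map_add, hf, hg, map_add, add_mul]
    | single n c => simp [inv_single, mul_comm]

end CLFree

/-- The defining relations of the Cohn-Leavitt algebra of the graph `G` relative to a set `S` of
regular vertices. -/
inductive CLRel (K : Type w) [Field K] {V : Type u} {E : Type v} (G : DirectedGraph V E)
    (S : Set V) : CLFree K V E → CLFree K V E → Prop
  /-- (V), equal vertices -/
  | v_same (x : V) :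
      CLRel K G S (CLFree.gen (.vert x) * CLFree.gen (.vert x)) (CLFree.gen (.vert x))
  /-- (V), distinct vertices -/
  | v_ne (x y : V) (h : x ≠ y) :
      CLRel K G S (CLFree.gen (.vert x) * CLFree.gen (.vert y)) 0
  /-- (E1), `s(e) e = e` -/
  | e1_left (e : E) :
      CLRel K G S (CLFree.gen (.vert (G.s e)) * CLFree.gen (.edge e)) (CLFree.gen (.edge e))
  /-- (E1), `e r(e) = e` -/
  | e1_right (e : E) :
      CLRel K G S (CLFree.gen (.edge e) * CLFree.gen (.vert (G.r e))) (CLFree.gen (.edge e))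
  /-- (E2), `r(e) e* = e*` -/
  | e2_left (e : E) :
      CLRel K G S (CLFree.gen (.vert (G.r e)) * CLFree.gen (.ghost e)) (CLFree.gen (.ghost e))
  /-- (E2), `e* s(e) = e*` -/
  | e2_right (e : E) :
      CLRel K G S (CLFree.gen (.ghost e) * CLFree.gen (.vert (G.s e))) (CLFree.gen (.ghost e))
  /-- (CK1), equal edges -/
  | ck1_same (e : E) :
      CLRel K G S (CLFree.gen (.ghost e) * CLFree.gen (.edge e)) (CLFree.gen (.vert (G.r e)))
  /-- (CK1), distinct edges -/
  | ck1_ne (e f : E) (h : e ≠ f) :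
      CLRel K G S (CLFree.gen (.ghost e) * CLFree.gen (.edge f)) 0
  /-- (SCK2) -/
  | sck2 (x : V) (hx : x ∈ S) (h : G.IsRegular x) :
      CLRel K G S (CLFree.gen (.vert x))
        (∑ e ∈ h.edges, CLFree.gen (.edge e) * CLFree.gen (.ghost e))

section Quotient

variable (K : Type w) [Field K] {V : Type u} {E : Type v} (G : DirectedGraph V E) (S : Set V)

/-- The `K`-multiples of the relations. (The free algebra is not unital, so the ideal of a ring
generated by the relations need not be closed under scalar multiplication.) -/
def CLScaledRel (a b : CLFree K V E) : Prop :=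
  ∃ (c : K) (a' b' : CLFree K V E), CLRel K G S a' b' ∧ a = c • a' ∧ b = c • b'

/-- The `K`-algebra congruence generated by the relations. -/
noncomputable def clCon : RingCon (CLFree K V E) := ringConGen (CLScaledRel K G S)

variable {K G S}

theorem clCon_smul (c : K) {a b : CLFree K V E} (h : clCon K G S a b) :
    clCon K G S (c • a) (c • b) := by
  change RingConGen.Rel (CLScaledRel K G S) a b at h
  induction h with
  | of x y h =>
    obtain ⟨d, x', y', h, rfl, rfl⟩ := h
    exact RingConGen.Rel.of _ _ ⟨c * d, x', y', h, (mul_smul ..).symm, (mul_smul ..).symm⟩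
  | refl x => exact RingConGen.Rel.refl _
  | symm _ ih => exact RingConGen.Rel.symm ih
  | trans _ _ ih1 ih2 => exact RingConGen.Rel.trans ih1 ih2
  | add _ _ ih1 ih2 =>
    rw [smul_add, smul_add]
    exact RingConGen.Rel.add ih1 ih2
  | mul _ h2 ih1 _ =>
    rw [← smul_mul_assoc, ← smul_mul_assoc]
    exact RingConGen.Rel.mul ih1 h2

theorem CLRel.inv [StarRing K] {a b : CLFree K V E} (h : CLRel K G S a b) :
    CLRel K G S (CLFree.inv a) (CLFree.inv b) := by
  cases h with
  | v_same x => simpa [CLFree.inv_mul, CLFree.inv_gen, CLGen.inv] using CLRel.v_same x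
  | v_ne x y h => simpa [CLFree.inv_mul, CLFree.inv_gen, CLGen.inv] using CLRel.v_ne y x (Ne.symm h)
  | e1_left e => simpa [CLFree.inv_mul, CLFree.inv_gen, CLGen.inv] using CLRel.e2_right e
  | e1_right e => simpa [CLFree.inv_mul, CLFree.inv_gen, CLGen.inv] using CLRel.e2_left e
  | e2_left e => simpa [CLFree.inv_mul, CLFree.inv_gen, CLGen.inv] using CLRel.e1_right e
  | e2_right e => simpa [CLFree.inv_mul, CLFree.inv_gen, CLGen.inv] using CLRel.e1_left e
  | ck1_same e => simpa [CLFree.inv_mul, CLFree.inv_gen, CLGen.inv] using CLRel.ck1_same e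
  | ck1_ne e f h => simpa [CLFree.inv_mul, CLFree.inv_gen, CLGen.inv] using CLRel.ck1_ne f e (Ne.symm h)
  | sck2 x hx h => simpa [CLFree.inv_mul, CLFree.inv_gen, CLGen.inv] using CLRel.sck2 x hx h

theorem clCon_inv [StarRing K] {a b : CLFree K V E} (h : clCon K G S a b) :
    clCon K G S (CLFree.inv a) (CLFree.inv b) := by
  change RingConGen.Rel (CLScaledRel K G S) a b at h
  induction h with
  | of x y h =>
    obtain ⟨d, x', y', h, rfl, rfl⟩ := h
    exact RingConGen.Rel.of _ _
      ⟨star d, _, _, h.inv, CLFree.inv_smul .., CLFree.inv_smul ..⟩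
  | refl x => exact RingConGen.Rel.refl _
  | symm _ ih => exact RingConGen.Rel.symm ih
  | trans _ _ ih1 ih2 => exact RingConGen.Rel.trans ih1 ih2
  | add _ _ ih1 ih2 =>
    rw [map_add CLFree.inv, map_add CLFree.inv]
    exact RingConGen.Rel.add ih1 ih2
  | mul _ _ ih1 ih2 =>
    rw [CLFree.inv_mul, CLFree.inv_mul]
    exact RingConGen.Rel.mul ih2 ih1

end Quotient

/-- The Cohn-Leavitt algebra `CL_K(G, S)`. -/
def CohnLeavitt (K : Type w) [Field K] {V : Type u} {E : Type v} (G : DirectedGraph V E)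
    (S : Set V) :=
  (clCon K G S).Quotient

namespace CohnLeavitt

variable {K : Type w} [Field K] {V : Type u} {E : Type v} {G : DirectedGraph V E} {S : Set V}

noncomputable instance : NonUnitalRing (CohnLeavitt K G S) :=
  inferInstanceAs (NonUnitalRing (clCon K G S).Quotient)

/-- The quotient map from the free algebra. -/
noncomputable def mk (a : CLFree K V E) : CohnLeavitt K G S := (a : (clCon K G S).Quotient)

theorem mk_surjective : Function.Surjective (mk : CLFree K V E → CohnLeavitt K G S) :=
  fun x => Quotient.inductionOn' x fun a => ⟨a, rfl⟩

theorem mk_add (a b : CLFree K V E) : (mk (a + b) : CohnLeavitt K G S) = mk a + mk b := rfl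

theorem mk_mul (a b : CLFree K V E) : (mk (a * b) : CohnLeavitt K G S) = mk a * mk b := rfl

theorem mk_zero : (mk 0 : CohnLeavitt K G S) = 0 := rfl

noncomputable instance : SMul K (CohnLeavitt K G S) :=
  ⟨fun c => Quotient.map' (fun a => c • a) fun _ _ h => clCon_smul c h⟩

theorem mk_smul (c : K) (a : CLFree K V E) : (mk (c • a) : CohnLeavitt K G S) = c • mk a := rfl

noncomputable instance : Module K (CohnLeavitt K G S) where
  one_smul x := by
    obtain ⟨a, rfl⟩ := mk_surjective x
    rw [← mk_smul, one_smul]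
  mul_smul c d x := by
    obtain ⟨a, rfl⟩ := mk_surjective x
    simp only [← mk_smul, mul_smul]
  smul_zero c := by rw [← mk_zero, ← mk_smul, smul_zero]
  smul_add c x y := by
    obtain ⟨a, rfl⟩ := mk_surjective x
    obtain ⟨b, rfl⟩ := mk_surjective y
    simp only [← mk_smul, ← mk_add, smul_add]
  add_smul c d x := by
    obtain ⟨a, rfl⟩ := mk_surjective x
    simp only [← mk_smul, ← mk_add, add_smul]
  zero_smul x := by
    obtain ⟨a, rfl⟩ := mk_surjective x
    rw [← mk_smul, zero_smul, mk_zero]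

instance : IsScalarTower K (CohnLeavitt K G S) (CohnLeavitt K G S) where
  smul_assoc c x y := by
    obtain ⟨a, rfl⟩ := mk_surjective x
    obtain ⟨b, rfl⟩ := mk_surjective y
    simp only [smul_eq_mul, ← mk_smul, ← mk_mul, smul_mul_assoc]

noncomputable instance : SMulCommClass K (CohnLeavitt K G S) (CohnLeavitt K G S) where
  smul_comm c x y := by
    obtain ⟨a, rfl⟩ := mk_surjective x
    obtain ⟨b, rfl⟩ := mk_surjective y
    simp only [smul_eq_mul, ← mk_smul, ← mk_mul, mul_smul_comm]

section Star

variable [StarRing K]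

/-- The involution of `CL_K(G, S)` induced by the involution of `K` and by `v* = v`,
`(e)* = e*`, `(e*)* = e`. -/
noncomputable instance : Star (CohnLeavitt K G S) :=
  ⟨Quotient.map' CLFree.inv fun _ _ h => clCon_inv h⟩

theorem star_mk (a : CLFree K V E) : star (mk a : CohnLeavitt K G S) = mk (CLFree.inv a) := rfl

noncomputable instance : StarRing (CohnLeavitt K G S) where
  star_involutive x := by
    obtain ⟨a, rfl⟩ := mk_surjective x
    rw [star_mk, star_mk, CLFree.inv_inv]
  star_mul x y := by
    obtain ⟨a, rfl⟩ := mk_surjective x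
    obtain ⟨b, rfl⟩ := mk_surjective y
    simp only [← mk_mul, star_mk, CLFree.inv_mul]
  star_add x y := by
    obtain ⟨a, rfl⟩ := mk_surjective x
    obtain ⟨b, rfl⟩ := mk_surjective y
    simp only [← mk_add, star_mk, map_add]

instance : StarModule K (CohnLeavitt K G S) where
  star_smul c x := by
    obtain ⟨a, rfl⟩ := mk_surjective x
    simp only [← mk_smul, star_mk, CLFree.inv_smul]

end Star

/-- A vertex as an element of `CL_K(G, S)`. -/
noncomputable def vert (x : V) : CohnLeavitt K G S := mk (CLFree.gen (.vert x))

/-- An edge as an element of `CL_K(G, S)`. -/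
noncomputable def edge (e : E) : CohnLeavitt K G S := mk (CLFree.gen (.edge e))

/-- The element of `CL_K(G, S)` given by a start vertex and a list of edges: the vertex if the
list is empty, and otherwise the product of the edges (times the range of the last one, which
does not change the product, by (E1)). -/
noncomputable def walk : V → List E → CohnLeavitt K G S
  | x, [] => vert x
  | _, e :: l => edge e * walk (G.r e) l

/-- A path as an element of `CL_K(G, S)`. The ghost path `p*` is `star (path p)`. -/
noncomputable def path (p : G.Path) : CohnLeavitt K G S := walk p.source p.edges

end CohnLeavitt

/-! ### Positivity, traces -/

/-- An element of a `*`-ring is positive (`x ≥ 0`) if it is a finite sum of elements `y y*`. -/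
def IsPos {R : Type*} [NonUnitalRing R] [StarRing R] (x : R) : Prop :=
  ∃ (n : ℕ) (y : Fin n → R), x = ∑ i, y i * star (y i)

/-- `x > 0`: the element `x` is positive and nonzero. -/
def IsStrictPos {R : Type*} [NonUnitalRing R] [StarRing R] (x : R) : Prop :=
  IsPos x ∧ x ≠ 0

/-- The involution of `R` is positive definite. -/
def IsPosDefinite (R : Type*) [NonUnitalRing R] [StarRing R] : Prop :=
  ∀ (n : ℕ) (x : Fin n → R), ∑ i, x i * star (x i) = 0 → ∀ i, x i = 0

/-- A map is central if `t (x y) = t (y x)`; a trace is an additive central map. -/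
def IsCentralMap {A R : Type*} [NonUnitalRing A] (t : A → R) : Prop :=
  ∀ x y, t (x * y) = t (y * x)

/-- A map between `*`-rings is positive if it maps positive elements to positive elements. -/
def IsPosMap {A R : Type*} [NonUnitalRing A] [StarRing A] [NonUnitalRing R] [StarRing R]
    (t : A → R) : Prop :=
  ∀ x, IsPos x → IsPos (t x)

/-- A map between `*`-rings is faithful if `x > 0` implies `t x > 0`. -/
def IsFaithfulMap {A R : Type*} [NonUnitalRing A] [StarRing A] [NonUnitalRing R] [StarRing R]
    (t : A → R) : Prop :=
  ∀ x, IsStrictPos x → IsStrictPos (t x)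

namespace CohnLeavitt

variable {K : Type w} [Field K] [StarRing K] {V : Type u} {E : Type v} {G : DirectedGraph V E}
  {S : Set V} {R : Type*}

open Classical in
/-- `t` is canonical if `t (p q*) = δ_{p,q} t (r(p))` for all paths `p` and `q`. -/
def IsCanonical [Zero R] (t : CohnLeavitt K G S → R) : Prop :=
  ∀ p q : G.Path, t (path p * star (path q)) = if p = q then t (vert p.range) else 0

variable [NonUnitalRing R] [StarRing R]

/-- (P): `t (v - ∑_{e ∈ I} r(e)) ≥ 0` for all vertices `v` and finite `I ⊆ s⁻¹(v)`. -/
def CondP (t : CohnLeavitt K G S → R) : Prop :=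
  ∀ (x : V) (I : Finset E), (I : Set E) ⊆ G.emitted x →
    IsPos (t (vert x - ∑ e ∈ I, vert (G.r e)))

/-- (F): `t v > 0` for all vertices `v`. -/
def CondF (t : CohnLeavitt K G S → R) : Prop :=
  ∀ x : V, IsStrictPos (t (vert x))

/-- (SF): `t (v - ∑_{e ∈ s⁻¹(v)} r(e)) > 0` for all regular vertices `v` not in `S`. -/
def CondSF (t : CohnLeavitt K G S → R) : Prop :=
  ∀ (x : V) (h : G.IsRegular x), x ∉ S →
    IsStrictPos (t (vert x - ∑ e ∈ h.edges, vert (G.r e)))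

end CohnLeavitt

/-! ### Relations and paths in the Cohn-Leavitt algebra -/

namespace CohnLeavitt

section Relations

variable {K : Type*} [Field K] {V : Type*} {E : Type*} {G : DirectedGraph V E} {S : Set V}

/-! Everything rests on evaluating `t (x x*)`. Write `x = a + ∑ y_e e*` with `a` in the span of the
paths and `e` in a finite set `I`. Splitting `a` along vertices `v` and subtracting the defect `v -
∑ e e*` over the `e ∈ I` emitted by `v` gives `x = ∑ a (v - ∑ e e*) + ∑ (y_e + a e) e*`
(`exists_eq_sum_defect_add_sum`). These terms are mutually orthogonal. A term `z e*` has the same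
square as `z r(e)`, whose ghost paths are shorter; a term `a (v - ∑ e e*)` splits further into
multiples of `p (v - ∑ e e*)`, orthogonal under `t` because `t` is canonical. By induction on the
ghost length (`induction_orthogonal`), `t (x x*)` is a finite sum of elements `c c* t (r(p) - ∑
r(e))`. Hence (P) gives positivity.

If `R` is positive definite and `t (x x*) = 0`, every summand vanishes; by (F) and (SF) a defect
whose value under `t` is zero is itself zero (`defect_eq_zero`), so `x = 0`. Conversely, defects and
vertices are projections, and testing `t` on them yields the conditions. For strictness they must be
nonzero, which a representation on functions on a branching system shows (`vert_ne_zero`,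
`vert_ne_sum`). -/

theorem mk_eq_of_rel {a b : CLFree K V E} (h : CLRel K G S a b) :
    (mk a : CohnLeavitt K G S) = mk b :=
  (RingCon.eq _).2 (RingConGen.Rel.of _ _ ⟨1, a, b, h, (one_smul ..).symm, (one_smul ..).symm⟩)

theorem mk_sum {ι : Type*} (s : Finset ι) (a : ι → CLFree K V E) :
    (mk (∑ i ∈ s, a i) : CohnLeavitt K G S) = ∑ i ∈ s, mk (a i) := by
  classical
  induction s using Finset.induction_on with
  | empty => simp [mk_zero]
  | insert i s hi ih => rw [Finset.sum_insert hi, Finset.sum_insert hi, mk_add, ih]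

theorem vert_mul_self (x : V) : (vert x * vert x : CohnLeavitt K G S) = vert x :=
  mk_eq_of_rel (CLRel.v_same x)

theorem vert_mul_of_ne {x y : V} (h : x ≠ y) : (vert x * vert y : CohnLeavitt K G S) = 0 :=
  mk_eq_of_rel (CLRel.v_ne x y h)

theorem vert_mul_edge (e : E) : (vert (G.s e) * edge e : CohnLeavitt K G S) = edge e :=
  mk_eq_of_rel (CLRel.e1_left e)

theorem edge_mul_vert (e : E) : (edge e * vert (G.r e) : CohnLeavitt K G S) = edge e :=
  mk_eq_of_rel (CLRel.e1_right e)

theorem vert_mul_edge_of_ne {x : V} {e : E} (h : x ≠ G.s e) :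
    (vert x * edge e : CohnLeavitt K G S) = 0 := by
  rw [← vert_mul_edge, ← mul_assoc, vert_mul_of_ne h, zero_mul]

variable [StarRing K]

theorem star_vert (x : V) : star (vert x : CohnLeavitt K G S) = vert x := by
  rw [vert, star_mk, CLFree.inv_gen]; rfl

theorem star_edge (e : E) :
    star (edge e : CohnLeavitt K G S) = mk (CLFree.gen (.ghost e)) := by
  rw [edge, star_mk, CLFree.inv_gen]; rfl

theorem star_edge_mul_self (e : E) :
    (star (edge e) * edge e : CohnLeavitt K G S) = vert (G.r e) := by
  rw [star_edge]; exact mk_eq_of_rel (CLRel.ck1_same e)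

theorem star_edge_mul_of_ne {e f : E} (h : e ≠ f) :
    (star (edge e) * edge f : CohnLeavitt K G S) = 0 := by
  rw [star_edge]; exact mk_eq_of_rel (CLRel.ck1_ne e f h)

theorem vert_mul_star_edge (e : E) :
    (vert (G.r e) * star (edge e) : CohnLeavitt K G S) = star (edge e) := by
  rw [star_edge]; exact mk_eq_of_rel (CLRel.e2_left e)

theorem star_edge_mul_vert (e : E) :
    (star (edge e) * vert (G.s e) : CohnLeavitt K G S) = star (edge e) := by
  rw [star_edge]; exact mk_eq_of_rel (CLRel.e2_right e)

theorem star_edge_mul_vert_of_ne {x : V} {e : E} (h : G.s e ≠ x) :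
    (star (edge e) * vert x : CohnLeavitt K G S) = 0 := by
  rw [← star_edge_mul_vert, mul_assoc, vert_mul_of_ne h, mul_zero]

theorem vert_eq_sum {x : V} (hx : x ∈ S) (h : G.IsRegular x) :
    (vert x : CohnLeavitt K G S) = ∑ e ∈ h.edges, edge e * star (edge e) := by
  refine (mk_eq_of_rel (CLRel.sck2 x hx h)).trans ?_
  simp only [mk_sum, mk_mul, star_edge]; rfl

end Relations

end CohnLeavitt

/-! ### Extending paths by an edge -/

namespace DirectedGraph

variable {V : Type*} {E : Type*} {G : DirectedGraph V E}

theorem IsWalk.append_edge {x y : V} {l : List E} (h : G.IsWalk x l y) {e : E} (he : G.s e = y) :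
    G.IsWalk x (l ++ [e]) (G.r e) := by
  induction l generalizing x with
  | nil => exact ⟨he.trans (Eq.symm h), rfl⟩
  | cons f l ih => exact ⟨h.1, ih h.2⟩

/-- The path of length zero at a vertex. -/
def Path.nil (G : DirectedGraph V E) (x : V) : G.Path := ⟨x, [], x, rfl⟩

/-- A path extended by an edge. -/
def Path.concat (p : G.Path) (e : E) (he : G.s e = p.range) : G.Path :=
  ⟨p.source, p.edges ++ [e], G.r e, p.isWalk.append_edge he⟩

theorem Path.concat_injective {p q : G.Path} {e : E} {hp : G.s e = p.range}
    {hq : G.s e = q.range} (h : p.concat e hp = q.concat e hq) : p = q := by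
  have h1 := congrArg Path.source h
  have h2 := congrArg Path.edges h
  exact Path.ext h1 (List.append_cancel_right h2) (hp.symm.trans hq)

theorem IsRegular.mem_edges {x : V} (h : G.IsRegular x) {e : E} : e ∈ h.edges ↔ G.s e = x :=
  h.2.mem_toFinset

end DirectedGraph

/-! ### Paths as elements of the algebra, and their span -/

namespace CohnLeavitt

section Paths

variable {K : Type*} [Field K] {V : Type*} {E : Type*} {G : DirectedGraph V E} {S : Set V}

theorem walk_mul_vert {x y : V} {l : List E} (h : G.IsWalk x l y) :
    (walk x l * vert y : CohnLeavitt K G S) = walk x l := by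
  induction l generalizing x with
  | nil => obtain rfl : x = y := h; exact vert_mul_self x
  | cons e l ih => rw [walk, mul_assoc, ih h.2]

theorem walk_mul_edge {x y : V} {l : List E} (h : G.IsWalk x l y) {e : E} (he : G.s e = y) :
    (walk x l * edge e : CohnLeavitt K G S) = walk x (l ++ [e]) := by
  induction l generalizing x with
  | nil =>
    obtain rfl : x = y := h
    subst he
    rw [List.nil_append, walk, walk, walk, vert_mul_edge, edge_mul_vert]
  | cons f l ih => rw [walk, mul_assoc, ih h.2, List.cons_append, walk]

theorem path_nil (x : V) : (path (DirectedGraph.Path.nil G x) : CohnLeavitt K G S) = vert x := rfl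

theorem path_concat (p : G.Path) (e : E) (he : G.s e = p.range) :
    (path (p.concat e he) : CohnLeavitt K G S) = path p * edge e :=
  (walk_mul_edge p.isWalk he).symm

theorem path_mul_vert (p : G.Path) :
    (path p * vert p.range : CohnLeavitt K G S) = path p :=
  walk_mul_vert p.isWalk

theorem path_mul_vert_of_ne {p : G.Path} {x : V} (h : p.range ≠ x) :
    (path p * vert x : CohnLeavitt K G S) = 0 := by
  rw [← path_mul_vert, mul_assoc, vert_mul_of_ne h, mul_zero]

theorem path_mul_edge_of_ne {p : G.Path} {e : E} (h : p.range ≠ G.s e) :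
    (path p * edge e : CohnLeavitt K G S) = 0 := by
  rw [← path_mul_vert, mul_assoc, vert_mul_edge_of_ne h, mul_zero]

variable (K G S) in
/-- The span of the (real) paths. -/
noncomputable def pathSpan : Submodule K (CohnLeavitt K G S) := Submodule.span K (Set.range path)

theorem path_mem_pathSpan (p : G.Path) : path p ∈ pathSpan K G S :=
  Submodule.subset_span ⟨p, rfl⟩

theorem vert_mem_pathSpan (x : V) : vert x ∈ pathSpan K G S := path_mem_pathSpan (.nil G x)

theorem mul_mem_of_path_mul_mem {M : Submodule K (CohnLeavitt K G S)} {b : CohnLeavitt K G S}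
    (h : ∀ p : G.Path, path p * b ∈ M) {a : CohnLeavitt K G S} (ha : a ∈ pathSpan K G S) :
    a * b ∈ M := by
  have hle : pathSpan K G S ≤ M.comap (LinearMap.mulRight K b) := by
    refine Submodule.span_le.2 ?_
    rintro _ ⟨p, rfl⟩
    exact h p
  exact hle ha

theorem mul_vert_mem_pathSpan {a : CohnLeavitt K G S} (ha : a ∈ pathSpan K G S) (x : V) :
    a * vert x ∈ pathSpan K G S := by
  refine mul_mem_of_path_mul_mem (fun p => ?_) ha
  by_cases h : p.range = x
  · subst h; rw [path_mul_vert]; exact path_mem_pathSpan p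
  · rw [path_mul_vert_of_ne h]; exact zero_mem _

theorem mul_edge_mem_pathSpan {a : CohnLeavitt K G S} (ha : a ∈ pathSpan K G S) (e : E) :
    a * edge e ∈ pathSpan K G S := by
  refine mul_mem_of_path_mul_mem (fun p => ?_) ha
  by_cases h : p.range = G.s e
  · rw [← path_concat p e h.symm]; exact path_mem_pathSpan _
  · rw [path_mul_edge_of_ne h]; exact zero_mem _

/-- The vertices act as local units on the span of the paths. -/
theorem exists_sum_mul_vert_eq {a : CohnLeavitt K G S} (ha : a ∈ pathSpan K G S) :
    ∃ F : Finset V, ∀ F', F ⊆ F' → ∑ x ∈ F', a * vert x = a := by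
  classical
  induction ha using Submodule.span_induction with
  | mem a h =>
    obtain ⟨p, rfl⟩ := h
    refine ⟨{p.range}, fun F' h => ?_⟩
    rw [Finset.sum_eq_single_of_mem p.range (Finset.singleton_subset_iff.1 h)
      fun x _ hx => path_mul_vert_of_ne hx.symm, path_mul_vert]
  | zero => exact ⟨∅, fun F' _ => by simp⟩
  | add a b _ _ iha ihb =>
    obtain ⟨F₁, h₁⟩ := iha
    obtain ⟨F₂, h₂⟩ := ihb
    refine ⟨F₁ ∪ F₂, fun F' h => ?_⟩
    simp only [add_mul, Finset.sum_add_distrib]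
    rw [h₁ F' (Finset.union_subset_left h), h₂ F' (Finset.union_subset_right h)]
  | smul c a _ iha =>
    obtain ⟨F, h⟩ := iha
    refine ⟨F, fun F' h' => ?_⟩
    simp only [smul_mul_assoc, ← Finset.smul_sum]
    rw [h F' h']

end Paths

/-! ### The filtration by the length of the ghost paths -/

section Filtration

variable {K : Type*} [Field K] [StarRing K] {V : Type*} {E : Type*} {G : DirectedGraph V E}
  {S : Set V}

variable (K G S) in
/-- The span of the products `p q*` of paths with `q` of length at most `n`. -/
noncomputable def ghostLevel : ℕ → Submodule K (CohnLeavitt K G S)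
  | 0 => pathSpan K G S
  | n + 1 => pathSpan K G S ⊔
      ⨆ e : E, (ghostLevel n).map (LinearMap.mulRight K (star (edge e)))

theorem pathSpan_le_ghostLevel (n : ℕ) : pathSpan K G S ≤ ghostLevel K G S n := by
  cases n with
  | zero => exact le_rfl
  | succ n => exact le_sup_left

theorem mul_star_edge_mem_ghostLevel {n : ℕ} {z : CohnLeavitt K G S}
    (hz : z ∈ ghostLevel K G S n) (e : E) : z * star (edge e) ∈ ghostLevel K G S (n + 1) :=
  Submodule.mem_sup_right (Submodule.mem_iSup_of_mem e ⟨z, hz, rfl⟩)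

theorem ghostLevel_le_succ (n : ℕ) : ghostLevel K G S n ≤ ghostLevel K G S (n + 1) := by
  induction n with
  | zero => exact pathSpan_le_ghostLevel 1
  | succ n ih => exact sup_le_sup le_rfl (iSup_mono fun e => Submodule.map_mono ih)

theorem ghostLevel_mono : Monotone (ghostLevel K G S) := monotone_nat_of_le_succ ghostLevel_le_succ

theorem mem_ghostLevel_succ {n : ℕ} {x : CohnLeavitt K G S} (hx : x ∈ ghostLevel K G S (n + 1)) :
    ∃ a ∈ pathSpan K G S, ∃ (I : Finset E) (y : E → CohnLeavitt K G S),
      (∀ e, y e ∈ ghostLevel K G S n) ∧ x = a + ∑ e ∈ I, y e * star (edge e) := by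
  obtain ⟨a, ha, b, hb, rfl⟩ := Submodule.mem_sup.1 hx
  obtain ⟨f, hf, rfl⟩ := (Submodule.mem_iSup_iff_exists_finsupp _ _).1 hb
  choose y hy hy' using hf
  refine ⟨a, ha, f.support, y, hy, ?_⟩
  rw [Finsupp.sum]
  exact congrArg _ (Finset.sum_congr rfl fun e _ => (hy' e).symm)

/-- A submodule contains a filtration step if it contains the paths and the products `z e*` with
`z` in the previous step. -/
theorem ghostLevel_succ_le {n : ℕ} {M : Submodule K (CohnLeavitt K G S)}
    (h₁ : pathSpan K G S ≤ M)
    (h₂ : ∀ z ∈ ghostLevel K G S n, ∀ e, z * star (edge e) ∈ M) :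
    ghostLevel K G S (n + 1) ≤ M := by
  refine sup_le h₁ (iSup_le fun e => ?_)
  rintro _ ⟨z, hz, rfl⟩
  exact h₂ z hz e

theorem mul_vert_mem_ghostLevel {n : ℕ} {z : CohnLeavitt K G S} (hz : z ∈ ghostLevel K G S n)
    (x : V) : z * vert x ∈ ghostLevel K G S n := by
  cases n with
  | zero => exact mul_vert_mem_pathSpan hz x
  | succ n =>
    refine ghostLevel_succ_le (M := (ghostLevel K G S (n + 1)).comap (LinearMap.mulRight K (vert x)))
      (fun a ha => pathSpan_le_ghostLevel (n + 1) (mul_vert_mem_pathSpan ha x)) (fun z hz e => ?_) hz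
    change z * star (edge e) * vert x ∈ ghostLevel K G S (n + 1)
    rw [mul_assoc]
    by_cases h : G.s e = x
    · subst h
      rw [star_edge_mul_vert]
      exact mul_star_edge_mem_ghostLevel hz e
    · rw [star_edge_mul_vert_of_ne h, mul_zero]
      exact zero_mem _

/-- By (CK1), `e* f` is zero or a vertex, so a real edge on the right can only shorten the ghost
path. -/
theorem mul_edge_mem_ghostLevel {n : ℕ} {z : CohnLeavitt K G S} (hz : z ∈ ghostLevel K G S n)
    (f : E) : z * edge f ∈ ghostLevel K G S n := by
  cases n with
  | zero => exact mul_edge_mem_pathSpan hz f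
  | succ n =>
    refine ghostLevel_succ_le (M := (ghostLevel K G S (n + 1)).comap (LinearMap.mulRight K (edge f)))
      (fun a ha => pathSpan_le_ghostLevel (n + 1) (mul_edge_mem_pathSpan ha f)) (fun z hz e => ?_) hz
    change z * star (edge e) * edge f ∈ ghostLevel K G S (n + 1)
    rw [mul_assoc]
    by_cases h : e = f
    · subst h
      rw [star_edge_mul_self]
      exact ghostLevel_le_succ n (mul_vert_mem_ghostLevel hz _)
    · rw [star_edge_mul_of_ne h, mul_zero]
      exact zero_mem _

theorem exists_mul_gen_mem_ghostLevel {n : ℕ} {z : CohnLeavitt K G S}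
    (hz : z ∈ ghostLevel K G S n) (g : CLGen V E) :
    ∃ m, z * mk (CLFree.gen g) ∈ ghostLevel K G S m := by
  cases g with
  | vert x => exact ⟨n, mul_vert_mem_ghostLevel hz x⟩
  | edge e => exact ⟨n, mul_edge_mem_ghostLevel hz e⟩
  | ghost e => exact ⟨n + 1, star_edge (K := K) (G := G) (S := S) e ▸ mul_star_edge_mem_ghostLevel hz e⟩

/-- The word is absorbed letter by letter from the left, so both `z` and its level vary in the
induction; only a ghost letter may raise the level. -/
theorem exists_mul_word_mem_ghostLevel (w : FreeSemigroup (CLGen V E)) {n : ℕ}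
    {z : CohnLeavitt K G S} (hz : z ∈ ghostLevel K G S n) :
    ∃ m, z * mk (MonoidAlgebra.single w 1) ∈ ghostLevel K G S m := by
  induction w generalizing n z with
  | ih1 g => exact exists_mul_gen_mem_ghostLevel hz g
  | ih2 g w h1 h2 =>
    obtain ⟨m, hm⟩ := h1 hz
    have : (MonoidAlgebra.single (FreeSemigroup.of g * w) 1 : CLFree K V E)
        = MonoidAlgebra.single (FreeSemigroup.of g) 1 * MonoidAlgebra.single w 1 := by
      rw [MonoidAlgebra.single_mul_single, one_mul]
    rw [this, mk_mul, ← mul_assoc]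
    exact h2 hm

/-- The algebra need not have a unit, so the first letter of a word has no predecessor to multiply;
a vertex acting as its left unit takes that place. -/
theorem exists_gen_mem_ghostLevel (g : CLGen V E) :
    ∃ m, (mk (CLFree.gen g) : CohnLeavitt K G S) ∈ ghostLevel K G S m := by
  cases g with
  | vert x => exact ⟨0, vert_mem_pathSpan x⟩
  | edge e =>
    refine ⟨0, ?_⟩
    have := mul_edge_mem_pathSpan (vert_mem_pathSpan (K := K) (G := G) (S := S) (G.s e)) e
    rwa [vert_mul_edge] at this
  | ghost e =>
    refine ⟨1, ?_⟩
    have := mul_star_edge_mem_ghostLevel (n := 0) (vert_mem_pathSpan (K := K) (G := G) (S := S) (G.r e)) e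
    rwa [vert_mul_star_edge, star_edge] at this

/-- The products `p q*` of paths span the Cohn-Leavitt algebra. -/
theorem exists_mem_ghostLevel (x : CohnLeavitt K G S) : ∃ n, x ∈ ghostLevel K G S n := by
  obtain ⟨a, rfl⟩ := mk_surjective x
  induction a using MonoidAlgebra.induction_linear with
  | zero => exact ⟨0, zero_mem _⟩
  | add a b ha hb =>
    obtain ⟨m, hm⟩ := ha
    obtain ⟨n, hn⟩ := hb
    exact ⟨max m n, add_mem (ghostLevel_mono (le_max_left m n) hm)
      (ghostLevel_mono (le_max_right m n) hn)⟩
  | single w c =>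
    have hw : ∃ m, (mk (MonoidAlgebra.single w 1) : CohnLeavitt K G S) ∈ ghostLevel K G S m := by
      induction w with
      | ih1 g => exact exists_gen_mem_ghostLevel g
      | ih2 g w h1 h2 =>
        obtain ⟨m, hm⟩ := h1
        obtain ⟨n, hn⟩ := exists_mul_word_mem_ghostLevel w hm
        refine ⟨n, ?_⟩
        rwa [← mk_mul, MonoidAlgebra.single_mul_single, one_mul] at hn
    obtain ⟨m, hm⟩ := hw
    refine ⟨m, ?_⟩
    have := Submodule.smul_mem _ c hm
    rwa [← mk_smul, MonoidAlgebra.smul_single, smul_eq_mul, mul_one] at this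

end Filtration

end CohnLeavitt

/-! ### A representation in which vertices and their defects do not vanish -/

/-- For every vertex `x` a large set `T` is partitioned into copies of itself indexed by the edges
emitted by `x`, and by one more index exactly when `x` is not in `S`. -/
theorem DirectedGraph.exists_branching {V : Type*} {E : Type v} (G : DirectedGraph V E) (S : Set V)
    (hS : ∀ x ∈ S, G.IsRegular x) :
    ∃ (T : Type v) (d : V → T → T × Option E) (c : E → T → T), Nonempty T ∧
      (∀ e u, d (G.s e) (c e u) = (u, some e)) ∧
      (∀ x u e, (d x u).2 = some e → G.s e = x ∧ c e (d x u).1 = u) ∧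
      (∀ x ∈ S, ∀ u, (d x u).2 ≠ none) ∧
      (∀ x ∉ S, ∃ u, (d x u).2 = none) := by
  -- Infinite, and large enough to receive an injection from every index set `Y x`: the edges go to
  -- `E`, the extra index to `0 : ℕ`.
  let T : Type v := ℕ ⊕ E
  let Y : V → Type v := fun x =>
    {o : Option E // (o = none ∧ x ∉ S) ∨ ∃ e, o = some e ∧ G.s e = x}
  have hY : ∀ x, Nonempty (Y x) := by
    intro x
    by_cases hx : x ∈ S
    · obtain ⟨e, he⟩ := (hS x hx).1
      exact ⟨⟨some e, Or.inr ⟨e, rfl, he⟩⟩⟩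
    · exact ⟨⟨none, Or.inl ⟨rfl, hx⟩⟩⟩
  -- Cardinal arithmetic: an infinite cardinal absorbs a nonzero factor that does not exceed it.
  -- Regularity of the vertices in `S` is what makes `Y x` nonempty.
  have hcard : ∀ x, Nonempty (T × Y x ≃ T) := by
    intro x
    refine Cardinal.eq.1 ?_
    rw [← Cardinal.mul_def]
    refine Cardinal.mul_eq_left (Cardinal.aleph0_le_mk T) ?_ (Cardinal.mk_ne_zero_iff.2 (hY x))
    refine Cardinal.mk_le_of_injective (f := fun o : Y x =>
      (o.1.elim (Sum.inl 0) Sum.inr : ℕ ⊕ E)) ?_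
    rintro ⟨_ | e, h⟩ ⟨_ | f, h'⟩ h
    · rfl
    · cases h
    · cases h
    · cases h; rfl
  let φ : ∀ x, T × Y x ≃ T := fun x => (hcard x).some
  refine ⟨T, fun x u => (((φ x).symm u).1, ((φ x).symm u).2.1),
    fun e u => φ (G.s e) (u, ⟨some e, Or.inr ⟨e, rfl, rfl⟩⟩), ⟨Sum.inl 0⟩, ?_, ?_, ?_, ?_⟩
  · intro e u
    simp
  · intro x u e h
    obtain ⟨⟨u', o, ho⟩, rfl⟩ := (φ x).surjective u
    simp only [Equiv.symm_apply_apply] at h ⊢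
    subst h
    obtain ⟨h, _⟩ | ⟨f, h, rfl⟩ := ho
    · cases h
    · cases h
      exact ⟨rfl, rfl⟩
  · intro x hx u h
    obtain ⟨_, hx'⟩ | ⟨e, he, _⟩ := ((φ x).symm u).2.2
    · exact hx' hx
    · exact Option.some_ne_none e (he.symm.trans h)
  · intro x hx
    exact ⟨φ x (Sum.inl 0, ⟨none, Or.inl ⟨rfl, hx⟩⟩), by simp⟩

namespace CohnLeavitt

section Representation

variable {K : Type*} [Field K] {V : Type*} {E : Type*} {G : DirectedGraph V E} {S : Set V}
  {A : Type*} [Ring A] [Algebra K A]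

/-- The homomorphism from the free algebra given by the images of the generators. -/
noncomputable def freeLift (g : CLGen V E → A) : CLFree K V E →ₙₐ[K] A :=
  MonoidAlgebra.liftMagma K (FreeSemigroup.lift g)

theorem freeLift_gen (g : CLGen V E → A) (a : CLGen V E) :
    freeLift (K := K) g (CLFree.gen a) = g a := by
  simp [freeLift, CLFree.gen]

/-- The universal property of the quotient, phrased on representatives so that no induced map has to
be constructed. -/
theorem freeLift_eq_of_mk_eq {g : CLGen V E → A}
    (hg : ∀ a b, CLRel K G S a b → freeLift (K := K) g a = freeLift g b) {a b : CLFree K V E}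
    (h : (mk a : CohnLeavitt K G S) = mk b) : freeLift (K := K) g a = freeLift g b := by
  have h' : RingConGen.Rel (CLScaledRel K G S) a b := (RingCon.eq _).1 h
  clear h
  induction h' with
  | of x y h =>
    obtain ⟨c, x', y', h, rfl, rfl⟩ := h
    rw [map_smul, map_smul, hg _ _ h]
  | refl x => rfl
  | symm _ ih => exact ih.symm
  | trans _ _ ih1 ih2 => exact ih1.trans ih2
  | add _ _ ih1 ih2 => rw [map_add, map_add, ih1, ih2]
  | mul _ _ ih1 ih2 => rw [map_mul, map_mul, ih1, ih2]

open Classical in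
/-- The operators on `V × T → K` by which the generators act, for a branching system on `T`. -/
noncomputable def branchingRep (K : Type*) [Field K] (G : DirectedGraph V E) {T : Type*}
    (d : V → T → T × Option E) (c : E → T → T) : CLGen V E → Module.End K (V × T → K)
  | .vert x =>
    { toFun := fun f z => if z.1 = x then f z else 0
      map_add' := fun f g => by ext z; by_cases h : z.1 = x <;> simp [h]
      map_smul' := fun a f => by ext z; by_cases h : z.1 = x <;> simp [h] }
  | .edge e =>
    { toFun := fun f z => if (d z.1 z.2).2 = some e then f (G.r e, (d z.1 z.2).1) else 0
      map_add' := fun f g => by ext z; by_cases h : (d z.1 z.2).2 = some e <;> simp [h]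
      map_smul' := fun a f => by ext z; by_cases h : (d z.1 z.2).2 = some e <;> simp [h] }
  | .ghost e =>
    { toFun := fun f z => if z.1 = G.r e then f (G.s e, c e z.2) else 0
      map_add' := fun f g => by ext z; by_cases h : z.1 = G.r e <;> simp [h]
      map_smul' := fun a f => by ext z; by_cases h : z.1 = G.r e <;> simp [h] }

section Apply

variable {T : Type*} {d : V → T → T × Option E} {c : E → T → T} (f : V × T → K) (z : V × T)

open Classical in
theorem branchingRep_vert (x : V) :
    branchingRep K G d c (.vert x) f z = if z.1 = x then f z else 0 := rfl

open Classical in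
theorem branchingRep_edge (e : E) : branchingRep K G d c (.edge e) f z
    = if (d z.1 z.2).2 = some e then f (G.r e, (d z.1 z.2).1) else 0 := rfl

open Classical in
theorem branchingRep_ghost (e : E) : branchingRep K G d c (.ghost e) f z
    = if z.1 = G.r e then f (G.s e, c e z.2) else 0 := rfl

end Apply

/-- The piece of `{x} × T` labelled `e` is identified with `{r(e)} × T` by `d`, with inverse `c e`.
An edge transports functions to its piece and a ghost edge transports them back, so `e e*` is
restriction to the piece of `e`. Over `S` the pieces exhaust `{x} × T`, which is (SCK2). -/
theorem branchingRep_rel {T : Type*} {d : V → T → T × Option E} {c : E → T → T}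
    (h₁ : ∀ e u, d (G.s e) (c e u) = (u, some e))
    (h₂ : ∀ x u e, (d x u).2 = some e → G.s e = x ∧ c e (d x u).1 = u)
    (h₃ : ∀ x ∈ S, ∀ u, (d x u).2 ≠ none) (a b : CLFree K V E) (h : CLRel K G S a b) :
    freeLift (branchingRep K G d c) a = freeLift (branchingRep K G d c) b := by
  ext f z
  obtain ⟨x, u⟩ := z
  cases h with
  | v_same y =>
    simp only [map_mul, freeLift_gen, Module.End.mul_apply, branchingRep_vert]
    split_ifs <;> rfl
  | v_ne y y' h =>
    simp only [map_mul, freeLift_gen, Module.End.mul_apply, branchingRep_vert, map_zero]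
    split_ifs with h1 h2
    · exact absurd (h1.symm.trans h2) h
    all_goals rfl
  | e1_left e =>
    simp only [map_mul, freeLift_gen, Module.End.mul_apply, branchingRep_vert, branchingRep_edge]
    split_ifs with h1 h2 h2
    · rfl
    · rfl
    · exact absurd (h₂ _ _ _ h2).1.symm h1
    · rfl
  | e1_right e =>
    simp only [map_mul, freeLift_gen, Module.End.mul_apply, branchingRep_vert, branchingRep_edge,
      if_true]
  | e2_left e =>
    simp only [map_mul, freeLift_gen, Module.End.mul_apply, branchingRep_vert, branchingRep_ghost]
    split_ifs <;> rfl
  | e2_right e =>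
    simp only [map_mul, freeLift_gen, Module.End.mul_apply, branchingRep_vert, branchingRep_ghost,
      if_true]
  | ck1_same e =>
    simp only [map_mul, freeLift_gen, Module.End.mul_apply, branchingRep_vert, branchingRep_edge,
      branchingRep_ghost, h₁, if_true]
    split_ifs with h
    · rw [← h]
    · rfl
  | ck1_ne e e' h =>
    simp only [map_mul, freeLift_gen, Module.End.mul_apply, branchingRep_edge,
      branchingRep_ghost, map_zero]
    rw [h₁, if_neg fun h' => h (Option.some.inj h'), ite_self]
    rfl
  | sck2 y hy h =>
    simp only [map_sum, map_mul, freeLift_gen, LinearMap.sum_apply, Finset.sum_apply,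
      Module.End.mul_apply, branchingRep_vert, branchingRep_edge, branchingRep_ghost, if_true]
    split_ifs with hxy
    · subst hxy
      -- The label of `u` singles out the one summand that does not vanish at `(x, u)`.
      obtain ⟨e, he⟩ := Option.ne_none_iff_exists'.1 (h₃ x hy u)
      obtain ⟨hs, hc⟩ := h₂ _ _ _ he
      rw [Finset.sum_eq_single_of_mem e (h.mem_edges.2 hs), if_pos he, hs, hc]
      intro e' _ hne
      rw [if_neg]
      rw [he]
      exact fun h => hne (Option.some.inj h).symm
    · refine (Finset.sum_eq_zero fun e he => if_neg fun h' => hxy ?_).symm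
      exact (h₂ _ _ _ h').1.symm.trans (h.mem_edges.1 he)

/-- The vertex acts as restriction to the nonempty set `{x} × T`, so it does not kill the constant
function `1`. -/
theorem vert_ne_zero (hS : ∀ x ∈ S, G.IsRegular x) (x : V) : (vert x : CohnLeavitt K G S) ≠ 0 := by
  obtain ⟨T, d, c, ⟨u⟩, h₁, h₂, h₃, -⟩ := G.exists_branching S hS
  intro h
  have h' := freeLift_eq_of_mk_eq (branchingRep_rel (K := K) h₁ h₂ h₃) (h.trans mk_zero.symm)
  have h'' := congrFun (LinearMap.congr_fun h' (fun _ => 1)) (x, u)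
  rw [freeLift_gen, map_zero, branchingRep_vert, if_pos rfl] at h''
  exact one_ne_zero h''

/-- At a point over `x` that carries no label, every `e e*` gives `0` while the vertex acts as the
identity. -/
theorem vert_ne_sum [StarRing K] (hS : ∀ x ∈ S, G.IsRegular x) {x : V} (hx : x ∉ S)
    (I : Finset E) : (vert x : CohnLeavitt K G S) ≠ ∑ e ∈ I, edge e * star (edge e) := by
  obtain ⟨T, d, c, -, h₁, h₂, h₃, h₄⟩ := G.exists_branching S hS
  obtain ⟨u, hu⟩ := h₄ x hx
  intro h
  simp only [star_edge] at h
  simp only [edge, ← mk_mul, ← mk_sum] at h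
  have h' := freeLift_eq_of_mk_eq (branchingRep_rel (K := K) h₁ h₂ h₃) h
  have h'' := congrFun (LinearMap.congr_fun h' (fun _ => 1)) (x, u)
  simp [freeLift_gen, Module.End.mul_apply, branchingRep_vert, branchingRep_edge, hu] at h''

end Representation

end CohnLeavitt

/-! ### Positive elements -/

section Positive

variable {R : Type*} [NonUnitalRing R] [StarRing R]

theorem isPos_zero : IsPos (0 : R) := ⟨0, Fin.elim0, by simp⟩

theorem isPos_mul_star (y : R) : IsPos (y * star y) := ⟨1, fun _ => y, by simp⟩

theorem IsPos.add {a b : R} (ha : IsPos a) (hb : IsPos b) : IsPos (a + b) := by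
  obtain ⟨m, y, rfl⟩ := ha
  obtain ⟨n, z, rfl⟩ := hb
  exact ⟨m + n, Fin.append y z, by simp [Fin.sum_univ_add]⟩

theorem isPos_sum {ι : Type*} {s : Finset ι} {a : ι → R} (h : ∀ i ∈ s, IsPos (a i)) :
    IsPos (∑ i ∈ s, a i) :=
  Finset.sum_induction _ _ (fun _ _ => IsPos.add) isPos_zero h

/-- Each `c c* y y*` is `(c y)(c y)*`. -/
theorem IsPos.smul_star_smul {K : Type*} [CommRing K] [StarRing K] [Module K R]
    [IsScalarTower K R R] [SMulCommClass K R R] [StarModule K R] {a : R} (ha : IsPos a) (c : K) :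
    IsPos (c • star c • a) := by
  obtain ⟨n, y, rfl⟩ := ha
  refine ⟨n, fun i => c • y i, ?_⟩
  simp only [Finset.smul_sum, star_smul, smul_mul_assoc, mul_smul_comm]
  exact Finset.sum_congr rfl fun i _ => smul_comm _ _ _

/-- Positive definiteness is applied to the two families joined into one. -/
theorem IsPosDefinite.eq_zero_of_add_eq_zero (hR : IsPosDefinite R) {a b : R} (ha : IsPos a)
    (hb : IsPos b) (h : a + b = 0) : a = 0 ∧ b = 0 := by
  obtain ⟨m, y, rfl⟩ := ha
  obtain ⟨n, z, rfl⟩ := hb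
  have h0 := hR (m + n) (Fin.append y z) (by simpa [Fin.sum_univ_add] using h)
  constructor
  · refine Finset.sum_eq_zero fun i _ => ?_
    have := h0 (Fin.castAdd n i)
    rw [Fin.append_left] at this
    rw [this, zero_mul]
  · refine Finset.sum_eq_zero fun i _ => ?_
    have := h0 (Fin.natAdd m i)
    rw [Fin.append_right] at this
    rw [this, zero_mul]

theorem IsPosDefinite.eq_zero_of_sum_eq_zero (hR : IsPosDefinite R) {ι : Type*} {s : Finset ι}
    {a : ι → R} (ha : ∀ i ∈ s, IsPos (a i)) (h : ∑ i ∈ s, a i = 0) : ∀ i ∈ s, a i = 0 := by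
  classical
  intro i hi
  rw [← Finset.add_sum_erase s a hi] at h
  exact (hR.eq_zero_of_add_eq_zero (ha i hi)
    (isPos_sum fun j hj => ha j (Finset.mem_of_mem_erase hj)) h).1

end Positive

namespace CohnLeavitt

/-! ### Defects of vertices -/

section Defect

variable {K : Type*} [Field K] [StarRing K] {V : Type*} {E : Type*} {G : DirectedGraph V E}
  {S : Set V}

/-- The self-adjoint idempotent `v - ∑_{e ∈ I} e e*`. -/
noncomputable def defect (x : V) (I : Finset E) : CohnLeavitt K G S :=
  vert x - ∑ e ∈ I, edge e * star (edge e)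

theorem star_defect (x : V) (I : Finset E) :
    star (defect x I : CohnLeavitt K G S) = defect x I := by
  simp only [defect, star_sub, star_sum, star_mul, star_star, star_vert]

theorem defect_mul_edge_of_ne {x : V} {I : Finset E} (hI : (I : Set E) ⊆ G.emitted x) {e : E}
    (he : G.s e ≠ x) : (defect x I * edge e : CohnLeavitt K G S) = 0 := by
  rw [defect, sub_mul, vert_mul_edge_of_ne he.symm, Finset.sum_mul, zero_sub, neg_eq_zero]
  refine Finset.sum_eq_zero fun f hf => ?_
  rw [mul_assoc, star_edge_mul_of_ne, mul_zero]
  rintro rfl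
  exact he (hI hf)

/-- By (CK1) only the summand of `e` survives, and it cancels `v e = e`. -/
theorem defect_mul_edge_of_mem {x : V} {I : Finset E} (hI : (I : Set E) ⊆ G.emitted x) {e : E}
    (he : e ∈ I) : (defect x I * edge e : CohnLeavitt K G S) = 0 := by
  obtain rfl : G.s e = x := hI he
  rw [defect, sub_mul, vert_mul_edge, Finset.sum_mul, Finset.sum_eq_single_of_mem e he, mul_assoc,
    star_edge_mul_self, edge_mul_vert, sub_self]
  intro f _ hfe
  rw [mul_assoc, star_edge_mul_of_ne hfe, mul_zero]

theorem vert_mul_defect {x : V} {I : Finset E} (hI : (I : Set E) ⊆ G.emitted x) :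
    (vert x * defect x I : CohnLeavitt K G S) = defect x I := by
  rw [defect, mul_sub, vert_mul_self, Finset.mul_sum]
  congr 1
  refine Finset.sum_congr rfl fun e he => ?_
  obtain rfl : G.s e = x := hI he
  rw [← mul_assoc, vert_mul_edge]

theorem defect_mul_vert {x : V} {I : Finset E} (hI : (I : Set E) ⊆ G.emitted x) :
    (defect x I * vert x : CohnLeavitt K G S) = defect x I := by
  have h := congrArg star (vert_mul_defect (K := K) (S := S) hI)
  rwa [star_mul, star_defect, star_vert] at h

theorem defect_mul_self {x : V} {I : Finset E} (hI : (I : Set E) ⊆ G.emitted x) :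
    (defect x I * defect x I : CohnLeavitt K G S) = defect x I := by
  nth_rewrite 2 [defect]
  rw [mul_sub, defect_mul_vert hI, Finset.mul_sum, Finset.sum_eq_zero, sub_zero]
  intro e he
  rw [← mul_assoc, defect_mul_edge_of_mem hI he, zero_mul]

theorem defect_mul_of_ne {x y : V} (hxy : x ≠ y) {I J : Finset E} (hI : (I : Set E) ⊆ G.emitted x)
    (hJ : (J : Set E) ⊆ G.emitted y) : (defect x I * defect y J : CohnLeavitt K G S) = 0 := by
  rw [← defect_mul_vert hI, ← vert_mul_defect hJ, mul_assoc, ← mul_assoc (vert x),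
    vert_mul_of_ne hxy, zero_mul, mul_zero]

theorem path_mul_defect_of_ne {p : G.Path} {x : V} (hp : p.range ≠ x) {I : Finset E}
    (hI : (I : Set E) ⊆ G.emitted x) : (path p * defect x I : CohnLeavitt K G S) = 0 := by
  rw [← vert_mul_defect hI, ← mul_assoc, path_mul_vert_of_ne hp, zero_mul]

theorem mul_defect_mul_star {x : V} {I : Finset E} (hI : (I : Set E) ⊆ G.emitted x)
    (a b : CohnLeavitt K G S) :
    a * defect x I * star (b * defect x I) = a * defect x I * star b := by
  rw [star_mul, star_defect, mul_assoc, mul_assoc, ← mul_assoc (defect x I), defect_mul_self hI]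

/-- The orthogonal decomposition behind positivity: an element of the form `a + ∑ y_e e*`, with `a`
in the span of the paths, in terms of defects of vertices. -/
theorem exists_eq_sum_defect_add_sum [DecidableEq V] {a : CohnLeavitt K G S}
    (ha : a ∈ pathSpan K G S) (I : Finset E) (y : E → CohnLeavitt K G S) :
    ∃ F : Finset V, a + ∑ e ∈ I, y e * star (edge e)
      = ∑ x ∈ F, a * defect x {e ∈ I | G.s e = x}
        + ∑ e ∈ I, (y e + a * edge e) * star (edge e) := by
  obtain ⟨F, hF⟩ := exists_sum_mul_vert_eq ha
  -- The set must act as a local unit for `a` and also contain the source of every edge in `I`, so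
  -- that the fibres over it exhaust `I`.
  refine ⟨F ∪ I.image G.s, ?_⟩
  have h : ∑ x ∈ F ∪ I.image G.s, ∑ e ∈ I with G.s e = x, a * (edge e * star (edge e))
      = ∑ e ∈ I, a * (edge e * star (edge e)) :=
    Finset.sum_fiberwise_of_maps_to
      (fun e he => Finset.mem_union_right _ (Finset.mem_image_of_mem _ he)) _
  simp only [defect, mul_sub, Finset.sum_sub_distrib, hF _ Finset.subset_union_left,
    Finset.mul_sum, h, add_mul, Finset.sum_add_distrib, mul_assoc]
  abel

end Defect

/-! ### Canonical maps -/

section Canonical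

variable {K : Type*} [Field K] [StarRing K] {V : Type*} {E : Type*} {G : DirectedGraph V E}
  {S : Set V} {R : Type*} [NonUnitalRing R] [Module K R] {t : CohnLeavitt K G S →ₗ[K] R}

theorem IsCanonical.path_mul_star_self (hcan : IsCanonical t) (p : G.Path) :
    t (path p * star (path p)) = t (vert p.range) := by
  rw [hcan p p, if_pos rfl]

theorem IsCanonical.path_mul_star_of_ne (hcan : IsCanonical t) {p q : G.Path} (h : p ≠ q) :
    t (path p * star (path q)) = 0 := by
  rw [hcan p q, if_neg h]

theorem path_mul_defect_mul_star {p q : G.Path} {x : V} {I : Finset E} :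
    (path p * defect x I * star (path q) : CohnLeavitt K G S)
      = path p * vert x * star (path q)
        - ∑ e ∈ I, path p * edge e * star (path q * edge e) := by
  simp only [defect, mul_sub, sub_mul, Finset.mul_sum, Finset.sum_mul, star_mul, mul_assoc]

theorem IsCanonical.path_mul_defect_mul_star_self (hcan : IsCanonical t) (p : G.Path)
    {I : Finset E} (hI : (I : Set E) ⊆ G.emitted p.range) :
    t (path p * defect p.range I * star (path p))
      = t (vert p.range - ∑ e ∈ I, vert (G.r e)) := by
  rw [path_mul_defect_mul_star, path_mul_vert, map_sub, map_sub, map_sum, map_sum,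
    hcan.path_mul_star_self]
  congr 1
  refine Finset.sum_congr rfl fun e he => ?_
  rw [← path_concat p e (hI he), hcan.path_mul_star_self]
  rfl

/-- If both paths end in `x`, the product expands to `p q* - ∑ (p e)(q e)*`, and `p ≠ q` forces `p e
≠ q e`; otherwise the product is already zero. -/
theorem IsCanonical.path_mul_defect_mul_star_of_ne (hcan : IsCanonical t) {p q : G.Path}
    (hpq : p ≠ q) {x : V} {I : Finset E} (hI : (I : Set E) ⊆ G.emitted x) :
    t (path p * defect x I * star (path q)) = 0 := by
  by_cases hp : p.range = x
  swap
  · rw [path_mul_defect_of_ne hp hI, zero_mul, map_zero]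
  by_cases hq : q.range = x
  swap
  · have h := congrArg star (path_mul_defect_of_ne (K := K) (S := S) hq hI)
    rw [star_mul, star_defect, star_zero] at h
    rw [mul_assoc, h, mul_zero, map_zero]
  subst hp
  rw [path_mul_defect_mul_star, path_mul_vert, map_sub, map_sum, hcan.path_mul_star_of_ne hpq,
    zero_sub, neg_eq_zero]
  refine Finset.sum_eq_zero fun e he => ?_
  have he' : G.s e = p.range := hI he
  rw [← path_concat p e he', ← path_concat q e (he'.trans hq.symm)]
  exact hcan.path_mul_star_of_ne fun h => hpq (DirectedGraph.Path.concat_injective h)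

theorem IsCanonical.defect (hcan : IsCanonical t) (x : V) {I : Finset E}
    (hI : (I : Set E) ⊆ G.emitted x) :
    t (defect x I) = t (vert x - ∑ e ∈ I, vert (G.r e)) := by
  have h := hcan.path_mul_defect_mul_star_self (.nil G x) hI
  rw [path_nil, star_vert] at h
  refine Eq.trans ?_ h
  change _ = t (vert x * CohnLeavitt.defect x I * vert x)
  rw [vert_mul_defect hI, defect_mul_vert hI]

/-- Pairwise orthogonality makes each new summand orthogonal to the sum of the others, in both
orders. -/
theorem sum_induction_orthogonal {P : CohnLeavitt K G S → Prop} (zero : P 0)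
    (add : ∀ x y, t (x * star y) = 0 → t (y * star x) = 0 → P x → P y → P (x + y))
    {ι : Type*} (s : Finset ι) (f : ι → CohnLeavitt K G S) :
    (∀ i ∈ s, P (f i)) → (∀ i ∈ s, ∀ j ∈ s, i ≠ j → t (f i * star (f j)) = 0) →
      P (∑ i ∈ s, f i) := by
  classical
  induction s using Finset.induction_on with
  | empty => exact fun _ _ => zero
  | insert i s hi ih =>
    intro hP ho
    rw [Finset.sum_insert hi]
    refine add _ _ ?_ ?_ (hP i (Finset.mem_insert_self i s))
      (ih (fun j hj => hP j (Finset.mem_insert_of_mem hj)) fun j hj k hk =>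
        ho j (Finset.mem_insert_of_mem hj) k (Finset.mem_insert_of_mem hk))
    · rw [star_sum, Finset.mul_sum, map_sum]
      exact Finset.sum_eq_zero fun j hj => ho i (Finset.mem_insert_self i s) j
        (Finset.mem_insert_of_mem hj) (by rintro rfl; exact hi hj)
    · rw [Finset.sum_mul, map_sum]
      exact Finset.sum_eq_zero fun j hj => ho j (Finset.mem_insert_of_mem hj) i
        (Finset.mem_insert_self i s) (by rintro rfl; exact hi hj)

/-- A property `P` holds for all elements of the Cohn-Leavitt algebra if it is preserved by sums of
elements which are orthogonal with respect to `t`, and holds for the elementary elements. -/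
theorem induction_orthogonal (hcan : IsCanonical t) {P : CohnLeavitt K G S → Prop}
    (zero : P 0)
    (add : ∀ x y, t (x * star y) = 0 → t (y * star x) = 0 → P x → P y → P (x + y))
    (path_defect : ∀ (c : K) (p : G.Path) (I : Finset E), (I : Set E) ⊆ G.emitted p.range →
      P (c • (path p * defect p.range I)))
    (mul_star : ∀ z e, P (z * vert (G.r e)) → P (z * star (edge e)))
    (x : CohnLeavitt K G S) : P x := by
  classical
  -- Here orthogonality holds only after applying `t`: it comes from canonicity, for distinct paths.
  have base : ∀ a ∈ pathSpan K G S, ∀ (x : V) (I : Finset E), (I : Set E) ⊆ G.emitted x →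
      P (a * CohnLeavitt.defect x I) := by
    intro a ha x I hI
    obtain ⟨c, rfl⟩ := (Finsupp.mem_span_range_iff_exists_finsupp).1 ha
    rw [Finsupp.sum, Finset.sum_mul]
    refine sum_induction_orthogonal zero add _ _ (fun p _ => ?_) fun p _ q _ hpq => ?_
    · rw [smul_mul_assoc]
      by_cases hp : p.range = x
      · subst hp
        exact path_defect _ _ _ hI
      · rw [path_mul_defect_of_ne hp hI, smul_zero]
        exact zero
    · rw [mul_defect_mul_star hI, star_smul, smul_mul_assoc, smul_mul_assoc, mul_smul_comm,
        map_smul, map_smul, hcan.path_mul_defect_mul_star_of_ne hpq hI, smul_zero, smul_zero]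
  have step : ∀ a ∈ pathSpan K G S, ∀ (I : Finset E) (y : E → CohnLeavitt K G S),
      (∀ e ∈ I, P ((y e + a * edge e) * star (edge e))) →
      P (a + ∑ e ∈ I, y e * star (edge e)) := by
    intro a ha I y hy
    obtain ⟨F, hF⟩ := exists_eq_sum_defect_add_sum ha I y
    rw [hF]
    have hI : ∀ x, ((({e ∈ I | G.s e = x} : Finset E) : Set E)) ⊆ G.emitted x :=
      fun x e he => (Finset.mem_filter.1 he).2
    have hde : ∀ x, ∀ e ∈ I, (CohnLeavitt.defect x {e ∈ I | G.s e = x} * edge e :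
        CohnLeavitt K G S) = 0 := by
      intro x e he
      by_cases hx : G.s e = x
      · exact defect_mul_edge_of_mem (hI x) (Finset.mem_filter.2 ⟨he, hx⟩)
      · exact defect_mul_edge_of_ne (hI x) hx
    -- The defect part and the ghost part are orthogonal in the algebra itself, since each defect
    -- kills every edge of `I`.
    have hcross : (∑ x ∈ F, a * CohnLeavitt.defect x {e ∈ I | G.s e = x}) *
        star (∑ e ∈ I, (y e + a * edge e) * star (edge e)) = 0 := by
      rw [star_sum, Finset.sum_mul_sum]
      refine Finset.sum_eq_zero fun x _ => Finset.sum_eq_zero fun e he => ?_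
      rw [star_mul, star_star, mul_assoc, ← mul_assoc (CohnLeavitt.defect x _), hde x e he,
        zero_mul, mul_zero]
    refine add _ _ ?_ ?_ (sum_induction_orthogonal zero add _ _ (fun x _ => base a ha x _ (hI x)) fun x _ x' _ hx => ?_)
      (sum_induction_orthogonal zero add _ _ hy fun e _ e' _ he => ?_)
    · rw [hcross, map_zero]
    · have h := congrArg star hcross
      rw [star_mul, star_star, star_zero] at h
      rw [h, map_zero]
    · rw [star_mul, star_defect, mul_assoc, ← mul_assoc (CohnLeavitt.defect x _),
        defect_mul_of_ne hx (hI x) (hI x'), zero_mul, mul_zero, map_zero]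
    · rw [star_mul, star_star, mul_assoc, ← mul_assoc (star (edge e)), star_edge_mul_of_ne he,
        zero_mul, mul_zero, map_zero]
  obtain ⟨n, hx⟩ := exists_mem_ghostLevel x
  induction n generalizing x with
  -- With no ghost edges the decomposition is taken with `I = ∅`, so the defects are the vertices
  -- themselves.
  | zero => simpa using step x hx ∅ 0 (by simp)
  | succ n ih =>
    obtain ⟨a, ha, I, y, hy, rfl⟩ := mem_ghostLevel_succ hx
    -- The new coefficient `y_e + a e` still lies in level `n`, and so does its product with `r(e)`;
    -- this lets the induction hypothesis apply.
    refine step a ha I y fun e _ => mul_star _ _ (ih _ (mul_vert_mem_ghostLevel ?_ _))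
    exact add_mem (hy e) (pathSpan_le_ghostLevel n (mul_edge_mem_pathSpan ha e))

/-- Both sides equal `z r(e) z*`, because `e* e = r(e)`. This is how a ghost edge is removed without
changing the square. -/
theorem mul_vert_mul_star (z : CohnLeavitt K G S) (e : E) :
    z * star (edge e) * star (z * star (edge e))
      = z * vert (G.r e) * star (z * vert (G.r e)) := by
  rw [star_mul, star_mul, star_star, star_vert, mul_assoc, mul_assoc, ← mul_assoc (star (edge e)),
    ← mul_assoc (vert (G.r e)), star_edge_mul_self, vert_mul_self]

theorem map_mul_star_add {x y : CohnLeavitt K G S} (hxy : t (x * star y) = 0)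
    (hyx : t (y * star x) = 0) :
    t ((x + y) * star (x + y)) = t (x * star x) + t (y * star y) := by
  rw [star_add, add_mul, mul_add, mul_add, map_add, map_add, map_add, hxy, hyx, add_zero, zero_add]

theorem IsCanonical.smul_path_mul_defect (hcan : IsCanonical t) (c : K) (p : G.Path)
    {I : Finset E} (hI : (I : Set E) ⊆ G.emitted p.range) :
    t (c • (path p * CohnLeavitt.defect p.range I) *
        star (c • (path p * CohnLeavitt.defect p.range I)))
      = c • star c • t (vert p.range - ∑ e ∈ I, vert (G.r e)) := by
  rw [star_smul, smul_mul_assoc, mul_smul_comm, mul_defect_mul_star hI, map_smul, map_smul,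
    hcan.path_mul_defect_mul_star_self p hI]

/-! ### The criteria for positivity and faithfulness -/

variable [StarRing R] [IsScalarTower K R R] [SMulCommClass K R R] [StarModule K R]

theorem IsCanonical.isPos_mul_star (hcan : IsCanonical t) (hP : CondP t) (x : CohnLeavitt K G S) :
    IsPos (t (x * star x)) := by
  refine induction_orthogonal hcan (P := fun x => IsPos (t (x * star x))) ?_ ?_ ?_ ?_ x
  · rw [zero_mul, map_zero]
    exact isPos_zero
  · intro x y hxy hyx hx hy
    rw [map_mul_star_add hxy hyx]
    exact hx.add hy
  · intro c p I hI
    rw [hcan.smul_path_mul_defect c p hI]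
    exact (hP _ _ hI).smul_star_smul c
  · intro z e h
    rwa [mul_vert_mul_star]

theorem IsCanonical.isPosMap_iff (hcan : IsCanonical t) : IsPosMap t ↔ CondP t := by
  constructor
  · intro h x I hI
    -- The value in (P) is `t (d d*)` for the projection `d`, the defect of `x` at `I`.
    rw [← hcan.defect x hI, ← defect_mul_self hI]
    nth_rewrite 2 [← star_defect]
    exact h _ (_root_.isPos_mul_star _)
  · rintro hP x ⟨n, y, rfl⟩
    rw [map_sum]
    exact isPos_sum fun i _ => hcan.isPos_mul_star hP (y i)

omit [IsScalarTower K R R] [SMulCommClass K R R] [StarModule K R] in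
-- A value zero is possible only when `I` is all of `s⁻¹(x)` and `x ∈ S`, where (SCK2) makes the
-- defect vanish: (F) excludes sinks and every `I` that misses an edge, and (SF) excludes regular
-- vertices outside `S`.
theorem defect_eq_zero (hR : IsPosDefinite R) (hP : CondP t)
    (hF : CondF t) (hSF : CondSF t) {x : V} {I : Finset E} (hI : (I : Set E) ⊆ G.emitted x)
    (h : t (vert x - ∑ e ∈ I, vert (G.r e)) = 0) :
    (CohnLeavitt.defect x I : CohnLeavitt K G S) = 0 := by
  classical
  by_cases hfull : G.emitted x ⊆ I
  · rcases I.eq_empty_or_nonempty with rfl | ⟨e, he⟩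
    · rw [Finset.sum_empty, sub_zero] at h
      exact absurd h (hF x).2
    · have hreg : G.IsRegular x := ⟨⟨e, hI he⟩, I.finite_toSet.subset hfull⟩
      obtain rfl : I = hreg.edges := by
        ext f
        rw [hreg.mem_edges]
        exact ⟨fun hf => hI hf, fun hf => hfull hf⟩
      by_cases hx : x ∈ S
      · rw [CohnLeavitt.defect, ← vert_eq_sum hx hreg, sub_self]
      · exact absurd h (hSF x hreg hx).2
  · obtain ⟨e, he, heI⟩ := Set.not_subset.1 hfull
    have hI' : ((insert e I : Finset E) : Set E) ⊆ G.emitted x := by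
      rw [Finset.coe_insert]
      exact Set.insert_subset he hI
    -- Adding a missed edge `e` to `I` writes zero as a sum of two positive elements, one of which
    -- is `t (r(e))`, nonzero by (F).
    have hadd : t (vert x - ∑ f ∈ insert e I, vert (G.r f)) + t (vert (G.r e)) = 0 := by
      rw [← h, ← map_add, Finset.sum_insert heI]
      congr 1
      abel
    exact absurd (hR.eq_zero_of_add_eq_zero (hP x _ hI') (hF _).1 hadd).2 (hF _).2

theorem IsCanonical.eq_zero_of_mul_star (hcan : IsCanonical t) (hR : IsPosDefinite R)
    (hP : CondP t) (hF : CondF t) (hSF : CondSF t) (x : CohnLeavitt K G S)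
    (hx : t (x * star x) = 0) : x = 0 := by
  revert hx
  refine induction_orthogonal hcan (P := fun x => t (x * star x) = 0 → x = 0) ?_ ?_ ?_ ?_ x
  · exact fun _ => rfl
  · intro x y hxy hyx hx hy h
    rw [map_mul_star_add hxy hyx] at h
    obtain ⟨h1, h2⟩ := hR.eq_zero_of_add_eq_zero (hcan.isPos_mul_star hP x)
      (hcan.isPos_mul_star hP y) h
    rw [hx h1, hy h2, add_zero]
  · intro c p I hI h
    rw [hcan.smul_path_mul_defect c p hI, smul_eq_zero, smul_eq_zero, star_eq_zero] at h
    rcases h with h | h | h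
    · rw [h, zero_smul]
    · rw [h, zero_smul]
    · rw [defect_eq_zero hR hP hF hSF hI h, mul_zero, smul_zero]
  · intro z e h hz
    rw [mul_vert_mul_star] at hz
    -- Since `z e* = z r(e) e*`, it is enough that `z r(e)` vanishes.
    rw [← vert_mul_star_edge, ← mul_assoc, h hz, zero_mul]

theorem IsCanonical.isFaithfulMap_iff (hcan : IsCanonical t) (hS : ∀ x ∈ S, G.IsRegular x)
    (hR : IsPosDefinite R) : IsFaithfulMap t ↔ CondP t ∧ CondF t ∧ CondSF t := by
  constructor
  · intro h
    refine ⟨hcan.isPosMap_iff.1 fun x hx => ?_, fun x => h _ ⟨?_, vert_ne_zero hS x⟩, ?_⟩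
    -- Faithfulness speaks only of nonzero elements, so positivity at zero is separate.
    · by_cases hx0 : x = 0
      · rw [hx0, map_zero]
        exact isPos_zero
      · exact (h x ⟨hx, hx0⟩).1
    · rw [← vert_mul_self]
      nth_rewrite 2 [← star_vert]
      exact _root_.isPos_mul_star _
    · intro x hreg hx
      have hI : (hreg.edges : Set E) ⊆ G.emitted x := fun e he => hreg.mem_edges.1 he
      rw [← hcan.defect x hI]
      refine h _ ⟨?_, sub_ne_zero.2 (vert_ne_sum hS hx _)⟩
      rw [← defect_mul_self hI]
      nth_rewrite 2 [← star_defect]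
      exact _root_.isPos_mul_star _
  · rintro ⟨hP, hF, hSF⟩ _ ⟨⟨n, y, rfl⟩, hne⟩
    have hpos : ∀ i ∈ Finset.univ, IsPos (t (y i * star (y i))) :=
      fun i _ => hcan.isPos_mul_star hP (y i)
    rw [map_sum]
    refine ⟨isPos_sum hpos, fun h => hne (Finset.sum_eq_zero fun i hi => ?_)⟩
    rw [hcan.eq_zero_of_mul_star hR hP hF hSF (y i) (hR.eq_zero_of_sum_eq_zero hpos h i hi),
      zero_mul]

end Canonical

end CohnLeavitt

theorem mainTheorem9
    {K : Type*} [Field K] [StarRing K]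
    {V : Type*} {E : Type*} (G : DirectedGraph V E)
    (S : Set V) (hS : ∀ x ∈ S, G.IsRegular x)
    {R : Type*} [NonUnitalRing R] [StarRing R] [Module K R] [IsScalarTower K R R]
    [SMulCommClass K R R] [StarModule K R]
    (t : CohnLeavitt K G S →ₗ[K] R)
    (ht : IsCentralMap t) (hcan : CohnLeavitt.IsCanonical t) :
    (IsPosMap t ↔ CohnLeavitt.CondP t) ∧
      (IsPosDefinite R →
        (IsFaithfulMap t ↔
          CohnLeavitt.CondP t ∧ CohnLeavitt.CondF t ∧ CohnLeavitt.CondSF t)) :=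
  ⟨hcan.isPosMap_iff, hcan.isFaithfulMap_iff hS⟩
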